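/- Let $G$ and $H$ be finite-dimensional real Lie groups with Lie algebras $\mathfrak g,\mathfrak h$ (bracket of left-invariant vector fields), forming a matched pair: $H$ acts smoothly on $G$ from the left, $(h,g)\mapsto h\vartriangleright g$, $G$ acts smoothly on $H$ from the right, $(h,g)\mapsto h\vartriangleleft g$, and $h\vartriangleright(g_1g_2)=(h\vartriangleright g_1)\big((h\vartriangleleft g_1)\vartriangleright g_2\big)$, $(h_1h_2)\vartriangleleft g=\big(h_1\vartriangleleft(h_2\vartriangleright g)\big)(h_2\vartriangleleft g)$, $h\vartriangleright e_G=e_G$, $e_H\vartriangleleft g=e_H$. Let $G\bowtie H$ be the Lie group $G\times H$ with product $(g_1,h_1)(g_2,h_2)=(g_1(h_1\vartriangleright g_2),(h_1\vartriangleleft g_2)h_2)$. Notation. $R_g$ is the right translation $x\mapsto xg$ and $TR_g:\mathfrak g\to T_gG$ is the tangent map of $R_g$ at $e_G$ (similarly $TR_h$ on $H$ and $TR_{(g,h)}$ on $G\bowtie H$). With $\rho_g(h)=h\vartriangleright g$, write $\eta\vartriangleright g=T_{e_H}\rho_g(\eta)\in T_gG$ for $\eta\in\mathfrak h$; with $\sigma_g(h)=h\vartriangleleft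 g$, write $\eta\vartriangleleft g=T_{e_H}\sigma_g(\eta)\in\mathfrak h$; $h\vartriangleright\xi\in\mathfrak g$ is the image of $\xi\in\mathfrak g$ under the tangent map at $e_G$ of $g\mapsto h\vartriangleright g$. The infinitesimal actions $\eta\vartriangleright\xi\in\mathfrak g$ and $\eta\vartriangleleft\xi\in\mathfrak h$ are the derivatives of $h\mapsto h\vartriangleright\xi$ at $e_H$ in the direction $\eta$ and of $g\mapsto\eta\vartriangleleft g$ at $e_G$ in the direction $\xi$. The bracket on $\mathfrak g\bowtie\mathfrak h=\mathfrak g\oplus\mathfrak h$ is $$[(\xi_1,\eta_1),(\xi_2,\eta_2)]=\big([\xi_1,\xi_2]+\eta_1\vartriangleright\xi_2-\eta_2\vartriangleright\xi_1,\ [\eta_1,\eta_2]+\eta_1\vartriangleleft\xi_2-\eta_2\vartriangleleft\xi_1\big).$$ For $\mu\in\mathfrak g^*$, $\nu\in\mathfrak h^*$ put $\langle\mathrm{ad}^*_\xi\mu,\xi'\rangle=-\langle\mu,[\xi,\xi']\rangle$ (likewise on $\mathfrak h^*$ and on $(\mathfrak g\bowtie\mathfrak h)^*=\mathfrak g^*\oplus\mathfrak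 h^*$), $\langle\mu\overset{*}{\vartriangleleft}\eta,\xi\rangle=\langle\mu,\eta\vartriangleright\xi\rangle=\langle\mathfrak b^*_\xi\mu,\eta\rangle$, $\langle\xi\overset{*}{\vartriangleright}\nu,\eta\rangle=\langle\nu,\eta\vartriangleleft\xi\rangle=\langle\mathfrak a^*_\eta\nu,\xi\rangle$, $\langle g\overset{*}{\vartriangleright}\nu,\eta\rangle=\langle\nu,\eta\vartriangleleft g\rangle$. Let $T^*_{e_G}R_g$, $T^*_{e_H}R_h$ and $T^*_{e_H}\rho_g$ be the transposes of $TR_g$, $TR_h$ and $T_{e_H}\rho_g$. On the right-trivialized cotangent bundle $(\mathfrak g^*\oplus\mathfrak h^*)\rtimes(G\bowtie H)$ of $G\bowtie H$ let $\Omega$ be the canonical symplectic form: its values on the right-invariant vector fields $X_{(\hat\mu,\hat\nu,\xi,\eta)}(\mu,\nu,g,h)=\big((\hat\mu,\hat\nu)+\mathrm{ad}^*_{(\xi,\eta)}(\mu,\nu),\,TR_{(g,h)}(\xi,\eta)\big)$, which span every tangent space, are $$\Omega\big(X_{(\hat\mu_1,\hat\nu_1,\xi_1,\eta_1)},X_{(\hat\mu_2,\hat\nu_2,\xi_2,\eta_2)}\big)(\mu,\nu,g,h)=\langle(\hat\mu_2,\hat\nu_2),(\xi_1,\eta_1)\rangle-\langle(\hat\mu_1,\hat\nu_1),(\xi_2,\eta_2)\rangle+\langle(\mu,\nu),[(\xi_1,\eta_1),(\xi_2,\eta_2)]\rangle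 .$$ **Proposition.** Let $\mathcal H=\mathcal H(\mu,\nu,g,h)$ be a differentiable real-valued function on $(\mathfrak g^*\oplus\mathfrak h^*)\rtimes(G\bowtie H)$, with partial derivatives $\frac{\delta\mathcal H}{\delta\mu}\in\mathfrak g^{**}=\mathfrak g$, $\frac{\delta\mathcal H}{\delta\nu}\in\mathfrak h^{**}=\mathfrak h$, $\frac{\delta\mathcal H}{\delta g}\in T^*_gG$, $\frac{\delta\mathcal H}{\delta h}\in T^*_hH$. Then there is a unique vector field $X_{\mathcal H}$ with $\Omega(X_{\mathcal H},\cdot)=d\mathcal H$, and a curve $t\mapsto(\mu,\nu,g,h)$ defined on an interval (or any set of times, with derivatives taken within that set) satisfies Hamilton's equations, i.e. has velocity $X_{\mathcal H}$ at every time, if and only if $$\begin{cases} \dfrac{dg}{dt}=TR_g\Big(\dfrac{\delta\mathcal H}{\delta\mu}\Big)+\dfrac{\delta\mathcal H}{\delta\nu}\vartriangleright g,\\[2mm] \dfrac{dh}{dt}=TR_h\Big(\dfrac{\delta\mathcal H}{\delta\nu}\vartriangleleft g\Big),\\[2mm] \dfrac{d\mu}{dt}=-T^*_{e_G}R_g\Big(\dfrac{\delta\mathcal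 H}{\delta g}\Big)+\mathrm{ad}^*_{\frac{\delta\mathcal H}{\delta\mu}}\mu-\mu\overset{*}{\vartriangleleft}\dfrac{\delta\mathcal H}{\delta\nu}-\mathfrak a^*_{\frac{\delta\mathcal H}{\delta\nu}}\nu,\\[2mm] \dfrac{d\nu}{dt}=-T^*_{e_H}\rho_g\Big(\dfrac{\delta\mathcal H}{\delta g}\Big)-g\overset{*}{\vartriangleright}T^*_{e_H}R_h\Big(\dfrac{\delta\mathcal H}{\delta h}\Big)+\mathrm{ad}^*_{\frac{\delta\mathcal H}{\delta\nu}}\nu+\dfrac{\delta\mathcal H}{\delta\mu}\overset{*}{\vartriangleright}\nu+\mathfrak b^*_{\frac{\delta\mathcal H}{\delta\mu}}\mu. \end{cases}$$ -/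

import Mathlib

open scoped Manifold ContDiff

noncomputable section

/-- The element of a finite-dimensional space `V` that represents a linear functional on the dual
space `V*`, under the canonical identification `V** = V`. -/
def ofBidual {V : Type*} [NormedAddCommGroup V] [NormedSpace ℝ V] [FiniteDimensional ℝ V]
    (φ : StrongDual ℝ (StrongDual ℝ V)) : V :=
  (Module.evalEquiv ℝ V).symm
    ((φ : StrongDual ℝ V →ₗ[ℝ] ℝ) ∘ₗ
      ((LinearMap.toContinuousLinearMap : (V →ₗ[ℝ] ℝ) ≃ₗ[ℝ] (V →L[ℝ] ℝ)) :
        (V →ₗ[ℝ] ℝ) →ₗ[ℝ] (V →L[ℝ] ℝ)))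

theorem apply_ofBidual {V : Type*} [NormedAddCommGroup V] [NormedSpace ℝ V]
    [FiniteDimensional ℝ V] (φ : StrongDual ℝ (StrongDual ℝ V)) (μ : StrongDual ℝ V) :
    μ (ofBidual φ) = φ μ := by
  have h := Module.apply_evalEquiv_symm_apply (R := ℝ) (M := V) (μ : V →ₗ[ℝ] ℝ)
    ((φ : StrongDual ℝ V →ₗ[ℝ] ℝ) ∘ₗ
      ((LinearMap.toContinuousLinearMap : (V →ₗ[ℝ] ℝ) ≃ₗ[ℝ] (V →L[ℝ] ℝ)) :
        (V →ₗ[ℝ] ℝ) →ₗ[ℝ] (V →L[ℝ] ℝ)))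
  exact h

section SingleGroup

variable {E : Type*} [NormedAddCommGroup E] [NormedSpace ℝ E] [FiniteDimensional ℝ E]
  (G : Type*) [TopologicalSpace G] [ChartedSpace E G] [Group G] [LieGroup 𝓘(ℝ, E) ∞ G]

/-- The adjoint action `ad_ξ = [ξ, ·]` of the Lie algebra `𝔤 = T_e G` on itself. In Mathlib the
tangent space `T_e G` is, by definition, the model space `E`. -/
def adj (ξ : E) : E →L[ℝ] E :=
  haveI : LieGroup 𝓘(ℝ, E) (minSmoothness ℝ 3) G :=
    LieGroup.of_le (n := ∞) (by
      rw [minSmoothness_of_isRCLikeNormedField]; exact ENat.LEInfty.out)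
  haveI : CompleteSpace E := FiniteDimensional.complete ℝ E
  LinearMap.toContinuousLinearMap
    (LieAlgebra.ad ℝ (GroupLieAlgebra 𝓘(ℝ, E) G) ξ : E →ₗ[ℝ] E)

theorem adj_apply (ξ₁ ξ₂ : E) :
    adj G ξ₁ ξ₂ =
      Bracket.bracket (L := GroupLieAlgebra 𝓘(ℝ, E) G) (M := GroupLieAlgebra 𝓘(ℝ, E) G) ξ₁ ξ₂ := rfl

/-- The coadjoint action of `𝔤` on `𝔤*`: `⟨ad*_ξ μ, ξ'⟩ = -⟨μ, [ξ, ξ']⟩`. -/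
def coadj (ξ : E) (μ : StrongDual ℝ E) : StrongDual ℝ E := -(μ ∘L adj G ξ)

variable {G} in
/-- The tangent map `T_e R_g : 𝔤 → T_g G` of the right translation `R_g : x ↦ x g`. -/
def tR (g : G) : E →L[ℝ] E := mfderiv 𝓘(ℝ, E) 𝓘(ℝ, E) (fun x : G => x * g) 1

end SingleGroup

theorem inTangentCoordinates_const_one {E : Type*} [NormedAddCommGroup E] [NormedSpace ℝ E]
    {G : Type*} [TopologicalSpace G] [ChartedSpace E G] [Group G] [LieGroup 𝓘(ℝ, E) ∞ G]
    {F : Type*} [NormedAddCommGroup F] [NormedSpace ℝ F]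
    {H : Type*} [TopologicalSpace H] [ChartedSpace F H] [One H] (f : H → G) (hf : ∀ x, f x = 1)
    (φ : H → E →L[ℝ] E) :
    inTangentCoordinates 𝓘(ℝ, E) 𝓘(ℝ, E) (fun _ : H => (1 : G)) f φ 1 = φ := by
  obtain rfl : f = fun _ => 1 := funext hf
  have : IsManifold 𝓘(ℝ, E) 1 G := IsManifold.of_le (n := ∞) (by exact ENat.LEInfty.out)
  funext x
  rw [inTangentCoordinates_eq (I := 𝓘(ℝ, E)) (I' := 𝓘(ℝ, E)) (fun _ : H => (1 : G))
    (fun _ : H => (1 : G)) φ (mem_chart_source E (1 : G)) (mem_chart_source E (1 : G))]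
  ext v
  simp only [ContinuousLinearMap.comp_apply]
  rw [(tangentBundleCore 𝓘(ℝ, E) G).coordChange_self _ _ (mem_achart_source E (1 : G)),
    (tangentBundleCore 𝓘(ℝ, E) G).coordChange_self _ _ (mem_achart_source E (1 : G))]

/-- A matched pair of Lie groups `(G, H)`: a smooth left action `ρ h g = h ▷ g` of `H` on `G` and a
smooth right action `σ h g = h ◁ g` of `G` on `H`, compatible with each other. -/
structure LieMatchedPair (E F G H : Type*)
    [NormedAddCommGroup E] [NormedSpace ℝ E] [FiniteDimensional ℝ E]
    [NormedAddCommGroup F] [NormedSpace ℝ F] [FiniteDimensional ℝ F]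
    [TopologicalSpace G] [ChartedSpace E G] [Group G] [LieGroup 𝓘(ℝ, E) ∞ G]
    [TopologicalSpace H] [ChartedSpace F H] [Group H] [LieGroup 𝓘(ℝ, F) ∞ H] where
  ρ : H → G → G
  σ : H → G → H
  smooth_ρ : ContMDiff (𝓘(ℝ, F).prod 𝓘(ℝ, E)) 𝓘(ℝ, E) ∞ (fun p : H × G => ρ p.1 p.2)
  smooth_σ : ContMDiff (𝓘(ℝ, F).prod 𝓘(ℝ, E)) 𝓘(ℝ, F) ∞ (fun p : H × G => σ p.1 p.2)
  one_ρ : ∀ g, ρ 1 g = g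
  mul_ρ : ∀ h₁ h₂ g, ρ (h₁ * h₂) g = ρ h₁ (ρ h₂ g)
  σ_one : ∀ h, σ h 1 = h
  σ_mul : ∀ h g₁ g₂, σ h (g₁ * g₂) = σ (σ h g₁) g₂
  ρ_mul : ∀ h g₁ g₂, ρ h (g₁ * g₂) = ρ h g₁ * ρ (σ h g₁) g₂
  mul_σ : ∀ h₁ h₂ g, σ (h₁ * h₂) g = σ h₁ (ρ h₂ g) * σ h₂ g
  ρ_one : ∀ h, ρ h 1 = 1
  one_σ : ∀ g, σ 1 g = 1

namespace LieMatchedPair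

variable {E F G H : Type*}
    [NormedAddCommGroup E] [NormedSpace ℝ E] [FiniteDimensional ℝ E]
    [NormedAddCommGroup F] [NormedSpace ℝ F] [FiniteDimensional ℝ F]
    [TopologicalSpace G] [ChartedSpace E G] [Group G] [LieGroup 𝓘(ℝ, E) ∞ G]
    [TopologicalSpace H] [ChartedSpace F H] [Group H] [LieGroup 𝓘(ℝ, F) ∞ H]

/-! ### The matched pair Lie group `G ⋈ H` -/

/-- The matched pair group `G ⋈ H`: the product manifold `G × H` with the multiplication
`(g₁, h₁) (g₂, h₂) = (g₁ (h₁ ▷ g₂), (h₁ ◁ g₂) h₂)`. -/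
def Bowtie (_M : LieMatchedPair E F G H) : Type _ := G × H

variable (M : LieMatchedPair E F G H)

instance : TopologicalSpace M.Bowtie := inferInstanceAs (TopologicalSpace (G × H))

instance : ChartedSpace (ModelProd E F) M.Bowtie :=
  inferInstanceAs (ChartedSpace (ModelProd E F) (G × H))

instance : Mul M.Bowtie := ⟨fun x y => (x.1 * M.ρ x.2 y.1, M.σ x.2 y.1 * y.2)⟩

instance : One M.Bowtie := ⟨((1 : G), (1 : H))⟩

instance : Inv M.Bowtie := ⟨fun x => (M.ρ x.2⁻¹ x.1⁻¹, M.σ x.2⁻¹ x.1⁻¹)⟩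

theorem bowtie_mul_def (x y : M.Bowtie) :
    x * y = ((x.1 * M.ρ x.2 y.1, M.σ x.2 y.1 * y.2) : G × H) := rfl

theorem bowtie_one_def : (1 : M.Bowtie) = ((1, 1) : G × H) := rfl

theorem bowtie_inv_def (x : M.Bowtie) :
    x⁻¹ = ((M.ρ x.2⁻¹ x.1⁻¹, M.σ x.2⁻¹ x.1⁻¹) : G × H) := rfl

instance : Group M.Bowtie :=
  Group.ofLeftAxioms
    (fun x y z => Prod.ext
      (show x.1 * M.ρ x.2 y.1 * M.ρ (M.σ x.2 y.1 * y.2) z.1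
          = x.1 * M.ρ x.2 (y.1 * M.ρ y.2 z.1) by
        simp only [M.ρ_mul, M.mul_ρ, mul_assoc])
      (show M.σ (M.σ x.2 y.1 * y.2) z.1 * z.2
          = M.σ x.2 (y.1 * M.ρ y.2 z.1) * (M.σ y.2 z.1 * z.2) by
        simp only [M.σ_mul, M.mul_σ, mul_assoc]))
    (fun x => Prod.ext
      (show 1 * M.ρ 1 x.1 = x.1 by simp only [M.one_ρ, one_mul])
      (show M.σ 1 x.1 * x.2 = x.2 by simp only [M.one_σ, one_mul]))
    (fun x => Prod.ext
      (show M.ρ x.2⁻¹ x.1⁻¹ * M.ρ (M.σ x.2⁻¹ x.1⁻¹) x.1 = 1 by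
        rw [← M.ρ_mul, inv_mul_cancel, M.ρ_one])
      (show M.σ (M.σ x.2⁻¹ x.1⁻¹) x.1 * x.2 = 1 by
        rw [← M.σ_mul, inv_mul_cancel, M.σ_one, inv_mul_cancel]))

/-- `G ⋈ H` is a Lie group. -/
instance : LieGroup (𝓘(ℝ, E).prod 𝓘(ℝ, F)) ∞ M.Bowtie where
  toIsManifold := inferInstanceAs (IsManifold (𝓘(ℝ, E).prod 𝓘(ℝ, F)) ∞ (G × H))
  contMDiff_mul := by
    have hρ := M.smooth_ρ
    have hσ := M.smooth_σ
    have h1 : ContMDiff ((𝓘(ℝ, E).prod 𝓘(ℝ, F)).prod (𝓘(ℝ, E).prod 𝓘(ℝ, F)))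
        (𝓘(ℝ, E).prod 𝓘(ℝ, F)) ∞
        (fun q : (G × H) × (G × H) =>
          (q.1.1 * M.ρ q.1.2 q.2.1, M.σ q.1.2 q.2.1 * q.2.2)) := by
      have a1 : ContMDiff ((𝓘(ℝ, E).prod 𝓘(ℝ, F)).prod (𝓘(ℝ, E).prod 𝓘(ℝ, F)))
          (𝓘(ℝ, F).prod 𝓘(ℝ, E)) ∞
          (fun q : (G × H) × (G × H) => (q.1.2, q.2.1)) :=
        (contMDiff_snd.comp contMDiff_fst).prodMk (contMDiff_fst.comp contMDiff_snd)
      exact ((contMDiff_fst.comp contMDiff_fst).mul (hρ.comp a1)).prodMk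
        ((hσ.comp a1).mul (contMDiff_snd.comp contMDiff_snd))
    exact h1
  contMDiff_inv := by
    have hρ := M.smooth_ρ
    have hσ := M.smooth_σ
    have h1 : ContMDiff (𝓘(ℝ, E).prod 𝓘(ℝ, F)) (𝓘(ℝ, E).prod 𝓘(ℝ, F)) ∞
        (fun q : G × H => (M.ρ q.2⁻¹ q.1⁻¹, M.σ q.2⁻¹ q.1⁻¹)) := by
      have a1 : ContMDiff (𝓘(ℝ, E).prod 𝓘(ℝ, F)) (𝓘(ℝ, F).prod 𝓘(ℝ, E)) ∞
          (fun q : G × H => (q.2⁻¹, q.1⁻¹)) :=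
        contMDiff_snd.inv.prodMk contMDiff_fst.inv
      exact (hρ.comp a1).prodMk (hσ.comp a1)
    exact h1

/-- The tangent map `T_{(e,e)} R_p : 𝔤 ⊕ 𝔥 → T_p (G ⋈ H)` of the right translation by `p` on
`G ⋈ H`. -/
def tRBowtie (p : M.Bowtie) : E × F →L[ℝ] E × F :=
  mfderiv (𝓘(ℝ, E).prod 𝓘(ℝ, F)) (𝓘(ℝ, E).prod 𝓘(ℝ, F)) (fun x : M.Bowtie => x * p) 1

/-- The tangent map `T_p R_{p⁻¹} : T_p (G ⋈ H) → 𝔤 ⊕ 𝔥`, the inverse of `tRBowtie`. -/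
def tRBowtieInv (p : M.Bowtie) : E × F →L[ℝ] E × F :=
  mfderiv (𝓘(ℝ, E).prod 𝓘(ℝ, F)) (𝓘(ℝ, E).prod 𝓘(ℝ, F)) (fun x : M.Bowtie => x * p⁻¹) p

theorem tRBowtieInv_tRBowtie (p : M.Bowtie) (ζ : E × F) :
    M.tRBowtieInv p (M.tRBowtie p ζ) = ζ := by
  have h1 : MDifferentiableAt (𝓘(ℝ, E).prod 𝓘(ℝ, F)) (𝓘(ℝ, E).prod 𝓘(ℝ, F))
      (fun x : M.Bowtie => x * p) 1 :=
    (contMDiff_mul_right (I := 𝓘(ℝ, E).prod 𝓘(ℝ, F)) (n := ∞) (a := p)).mdifferentiable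
      (by simp) 1
  have h2 : MDifferentiableAt (𝓘(ℝ, E).prod 𝓘(ℝ, F)) (𝓘(ℝ, E).prod 𝓘(ℝ, F))
      (fun x : M.Bowtie => x * p⁻¹) p :=
    (contMDiff_mul_right (I := 𝓘(ℝ, E).prod 𝓘(ℝ, F)) (n := ∞) (a := p⁻¹)).mdifferentiable
      (by simp) p
  have h2' : MDifferentiableAt (𝓘(ℝ, E).prod 𝓘(ℝ, F)) (𝓘(ℝ, E).prod 𝓘(ℝ, F))
      (fun x : M.Bowtie => x * p⁻¹) (1 * p) := by rw [one_mul]; exact h2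
  have h3 := mfderiv_comp (1 : M.Bowtie) h2' h1
  have h4 : (fun x : M.Bowtie => x * p⁻¹) ∘ (fun x : M.Bowtie => x * p) = id := by
    ext x : 1; simp
  rw [h4, mfderiv_id] at h3
  let T : M.Bowtie → (E × F →L[ℝ] E × F) := fun q =>
    mfderiv (𝓘(ℝ, E).prod 𝓘(ℝ, F)) (𝓘(ℝ, E).prod 𝓘(ℝ, F)) (fun x : M.Bowtie => x * p⁻¹) q
  have h5 : T (1 * p) (M.tRBowtie p ζ) = ζ := (DFunLike.congr_fun h3 ζ).symm
  rw [one_mul] at h5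
  exact h5

theorem tRBowtie_tRBowtieInv (p : M.Bowtie) (w : E × F) :
    M.tRBowtie p (M.tRBowtieInv p w) = w := by
  have h1 : (M.tRBowtieInv p : E × F →ₗ[ℝ] E × F) * (M.tRBowtie p : E × F →ₗ[ℝ] E × F) = 1 :=
    LinearMap.ext (M.tRBowtieInv_tRBowtie p)
  exact LinearMap.congr_fun (mul_eq_one_comm.mp h1) w

/-! ### Tangent lifts of the mutual actions -/

/-- `T_{e_H} ρ_g : 𝔥 → T_g G`, `η ↦ η ▷ g`. -/
def algOnGrp (g : G) : F →L[ℝ] E := mfderiv 𝓘(ℝ, F) 𝓘(ℝ, E) (fun h : H => M.ρ h g) 1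

/-- `T_{e_G} ρ_h : 𝔤 → 𝔤`, `ξ ↦ h ▷ ξ`. -/
def grpLeft (h : H) : E →L[ℝ] E := mfderiv 𝓘(ℝ, E) 𝓘(ℝ, E) (fun g : G => M.ρ h g) 1

/-- `T_{e_H} σ_g : 𝔥 → 𝔥`, `η ↦ η ◁ g`. -/
def grpRight (g : G) : F →L[ℝ] F := mfderiv 𝓘(ℝ, F) 𝓘(ℝ, F) (fun h : H => M.σ h g) 1

/-- The infinitesimal left action `η ▷ ξ` of `𝔥` on `𝔤`: the derivative at `e_H`, in the direction
`η`, of `h ↦ h ▷ ξ` (see `bMap_eq`). -/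
def infLeft : F →L[ℝ] E →L[ℝ] E := mfderiv 𝓘(ℝ, F) 𝓘(ℝ, E →L[ℝ] E) M.grpLeft 1

/-- The infinitesimal right action `η ◁ ξ` (here `infRight ξ η`) of `𝔤` on `𝔥`: the derivative at
`e_G`, in the direction `ξ`, of `g ↦ η ◁ g` (see `aMap_eq`). -/
def infRight : E →L[ℝ] F →L[ℝ] F := mfderiv 𝓘(ℝ, E) 𝓘(ℝ, F →L[ℝ] F) M.grpRight 1

theorem mdifferentiableAt_grpLeft :
    MDifferentiableAt 𝓘(ℝ, F) 𝓘(ℝ, E →L[ℝ] E) M.grpLeft 1 := by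
  have hs : ContMDiffAt (𝓘(ℝ, F).prod 𝓘(ℝ, E)) 𝓘(ℝ, E) ∞
      (Function.uncurry (fun (x : H) (y : G) => M.ρ x y)) (1, (1 : G)) :=
    M.smooth_ρ.contMDiffAt
  have h := ContMDiffAt.mfderiv (m := 1) (fun (x : H) (y : G) => M.ρ x y) (fun _ => (1 : G))
    hs contMDiffAt_const (by rw [one_add_one_eq_two]; exact ENat.LEInfty.out)
  have e := inTangentCoordinates_const_one (E := E) (F := F) (fun x : H => M.ρ x (1 : G)) M.ρ_one M.grpLeft
  have h' : ContMDiffAt 𝓘(ℝ, F) 𝓘(ℝ, E →L[ℝ] E) 1 M.grpLeft 1 := by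
    rw [← e]
    exact h
  exact h'.mdifferentiableAt one_ne_zero

theorem mdifferentiableAt_grpRight :
    MDifferentiableAt 𝓘(ℝ, E) 𝓘(ℝ, F →L[ℝ] F) M.grpRight 1 := by
  have hs : ContMDiffAt (𝓘(ℝ, E).prod 𝓘(ℝ, F)) 𝓘(ℝ, F) ∞
      (Function.uncurry (fun (x : G) (y : H) => M.σ y x)) (1, (1 : H)) :=
    (M.smooth_σ.comp (contMDiff_snd.prodMk contMDiff_fst)).contMDiffAt
  have h := ContMDiffAt.mfderiv (m := 1) (fun (x : G) (y : H) => M.σ y x) (fun _ => (1 : H))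
    hs contMDiffAt_const (by rw [one_add_one_eq_two]; exact ENat.LEInfty.out)
  have e := inTangentCoordinates_const_one (E := F) (F := E) (fun x : G => M.σ (1 : H) x) M.one_σ M.grpRight
  have h' : ContMDiffAt 𝓘(ℝ, E) 𝓘(ℝ, F →L[ℝ] F) 1 M.grpRight 1 := by
    rw [← e]
    exact h
  exact h'.mdifferentiableAt one_ne_zero

/-- `𝔟_ξ : 𝔥 → 𝔤`, `η ↦ η ▷ ξ`. -/
def bMap (ξ : E) : F →L[ℝ] E := M.infLeft.flip ξ

/-- `𝔞_η : 𝔤 → 𝔥`, `ξ ↦ η ◁ ξ`. -/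
def aMap (η : F) : E →L[ℝ] F := M.infRight.flip η

/-- `𝔟_ξ` is the derivative at `e_H` of `h ↦ h ▷ ξ`. -/
theorem bMap_eq (ξ : E) :
    M.bMap ξ = (mfderiv 𝓘(ℝ, F) 𝓘(ℝ, E) (fun h : H => M.grpLeft h ξ) 1 : F →L[ℝ] E) := by
  have h := (((ContinuousLinearMap.apply ℝ E ξ).hasMFDerivAt (x := M.grpLeft (1 : H))).comp 1
    M.mdifferentiableAt_grpLeft.hasMFDerivAt).mfderiv
  ext η
  exact (DFunLike.congr_fun h η).symm

/-- `𝔞_η` is the derivative at `e_G` of `g ↦ η ◁ g`. -/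
theorem aMap_eq (η : F) :
    M.aMap η = (mfderiv 𝓘(ℝ, E) 𝓘(ℝ, F) (fun g : G => M.grpRight g η) 1 : E →L[ℝ] F) := by
  have h := (((ContinuousLinearMap.apply ℝ F η).hasMFDerivAt (x := M.grpRight (1 : G))).comp 1
    M.mdifferentiableAt_grpRight.hasMFDerivAt).mfderiv
  ext ξ
  exact (DFunLike.congr_fun h ξ).symm

/-! ### Dual actions -/

/-- The right action of `𝔥` on `𝔤*`: `⟨μ ◁* η, ξ⟩ = ⟨μ, η ▷ ξ⟩`. -/
def dualRight (μ : StrongDual ℝ E) (η : F) : StrongDual ℝ E := μ ∘L M.infLeft η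

/-- The left action of `𝔤` on `𝔥*`: `⟨ξ ▷* ν, η⟩ = ⟨ν, η ◁ ξ⟩`. -/
def dualLeft (ξ : E) (ν : StrongDual ℝ F) : StrongDual ℝ F := ν ∘L M.infRight ξ

/-- The left action of the group `G` on `𝔥*`: `⟨g ▷* ν, η⟩ = ⟨ν, η ◁ g⟩`. -/
def grpDualLeft (g : G) (ν : StrongDual ℝ F) : StrongDual ℝ F := ν ∘L M.grpRight g

/-- `𝔞_η* : 𝔥* → 𝔤*`. -/
def aDual (η : F) (ν : StrongDual ℝ F) : StrongDual ℝ E := ν ∘L M.aMap η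

/-- `𝔟_ξ* : 𝔤* → 𝔥*`. -/
def bDual (ξ : E) (μ : StrongDual ℝ E) : StrongDual ℝ F := μ ∘L M.bMap ξ

/-! ### The matched pair Lie algebra `𝔤 ⋈ 𝔥` and its coadjoint action -/

/-- The Lie bracket of `𝔤 ⋈ 𝔥`, as the map `z₂ ↦ [z₁, z₂]`:
`[(ξ₁, η₁), (ξ₂, η₂)] =
  ([ξ₁, ξ₂] + η₁ ▷ ξ₂ - η₂ ▷ ξ₁, [η₁, η₂] + η₁ ◁ ξ₂ - η₂ ◁ ξ₁)`. -/
def bracket (z₁ : E × F) : E × F →L[ℝ] E × F :=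
  ((adj G z₁.1 + M.infLeft z₁.2) ∘L ContinuousLinearMap.fst ℝ E F
      - M.bMap z₁.1 ∘L ContinuousLinearMap.snd ℝ E F).prod
    (adj H z₁.2 ∘L ContinuousLinearMap.snd ℝ E F
      + M.aMap z₁.2 ∘L ContinuousLinearMap.fst ℝ E F
      - M.infRight z₁.1 ∘L ContinuousLinearMap.snd ℝ E F)

theorem bracket_apply (ξ₁ ξ₂ : E) (η₁ η₂ : F) :
    M.bracket (ξ₁, η₁) (ξ₂, η₂) =
      (adj G ξ₁ ξ₂ + M.infLeft η₁ ξ₂ - M.infLeft η₂ ξ₁,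
        adj H η₁ η₂ + M.infRight ξ₂ η₁ - M.infRight ξ₁ η₂) := rfl

/-- The coadjoint action of `𝔤 ⋈ 𝔥` on its dual `𝔤* ⊕ 𝔥*`:
`⟨ad*_z (μ, ν), z'⟩ = -⟨(μ, ν), [z, z']⟩`. -/
def coadjBowtie (z : E × F) (m : StrongDual ℝ E × StrongDual ℝ F) :
    StrongDual ℝ E × StrongDual ℝ F :=
  (-((m.1.coprod m.2) ∘L M.bracket z ∘L ContinuousLinearMap.inl ℝ E F),
    -((m.1.coprod m.2) ∘L M.bracket z ∘L ContinuousLinearMap.inr ℝ E F))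

/-! ### The trivialized cotangent bundle `(𝔤* ⊕ 𝔥*) ⋊ (G ⋈ H)` -/

/-- The right trivialization of `T*(G ⋈ H)`; its points are `((μ, ν), (g, h))`. -/
abbrev Phase (M : LieMatchedPair E F G H) : Type _ :=
  (StrongDual ℝ E × StrongDual ℝ F) × M.Bowtie

/-- The model with corners of `Phase`. -/
abbrev phaseModel (_M : LieMatchedPair E F G H) :=
  𝓘(ℝ, StrongDual ℝ E × StrongDual ℝ F).prod (𝓘(ℝ, E).prod 𝓘(ℝ, F))

/-- The tangent space of `Phase` at any of its points; its vectors are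
`((dμ, dν), (U_g, V_h))`. -/
abbrev PhaseTangent (_M : LieMatchedPair E F G H) : Type _ :=
  (StrongDual ℝ E × StrongDual ℝ F) × (E × F)

/-- The right invariant vector field generated by `((μ̂, ν̂), (ξ, η))`. -/
def rightInvField (Z : (StrongDual ℝ E × StrongDual ℝ F) × (E × F)) (p : M.Phase) :
    M.PhaseTangent :=
  (Z.1 + M.coadjBowtie Z.2 p.1, M.tRBowtie p.2 Z.2)

/-- The generator of the unique right invariant vector field with value `W` at `p`. -/
def generator (p : M.Phase) (W : M.PhaseTangent) :
    (StrongDual ℝ E × StrongDual ℝ F) × (E × F) :=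
  (W.1 - M.coadjBowtie (M.tRBowtieInv p.2 W.2) p.1, M.tRBowtieInv p.2 W.2)

theorem rightInvField_generator (p : M.Phase) (W : M.PhaseTangent) :
    M.rightInvField (M.generator p W) p = W := by
  simp [rightInvField, generator, tRBowtie_tRBowtieInv]

theorem generator_rightInvField (p : M.Phase)
    (Z : (StrongDual ℝ E × StrongDual ℝ F) × (E × F)) :
    M.generator p (M.rightInvField Z p) = Z := by
  simp [rightInvField, generator, tRBowtieInv_tRBowtie]

/-- The pairing of `𝔤* ⊕ 𝔥*` with `𝔤 ⊕ 𝔥`. -/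
def pairing (m : StrongDual ℝ E × StrongDual ℝ F) (z : E × F) : ℝ := m.1 z.1 + m.2 z.2

/-- The canonical symplectic two-form in the right trivialization. It is given by its values on
right invariant vector fields, which span every tangent space (`rightInvField_generator`):
`Ω(X_{(m₁, z₁)}, X_{(m₂, z₂)})(μ, ν, g, h) = ⟨m₂, z₁⟩ - ⟨m₁, z₂⟩ + ⟨(μ, ν), [z₁, z₂]⟩`. -/
def symplecticForm (p : M.Phase) (W₁ W₂ : M.PhaseTangent) : ℝ :=
  pairing (M.generator p W₂).1 (M.generator p W₁).2
    - pairing (M.generator p W₁).1 (M.generator p W₂).2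
    + pairing p.1 (M.bracket (M.generator p W₁).2 (M.generator p W₂).2)

/-- The values of the symplectic form on right invariant vector fields. -/
theorem symplecticForm_rightInvField (p : M.Phase)
    (m₁ m₂ : StrongDual ℝ E × StrongDual ℝ F) (z₁ z₂ : E × F) :
    M.symplecticForm p (M.rightInvField (m₁, z₁) p) (M.rightInvField (m₂, z₂) p) =
      pairing m₂ z₁ - pairing m₁ z₂ + pairing p.1 (M.bracket z₁ z₂) := by
  simp [symplecticForm, generator_rightInvField]

/-! ### Hamilton's equations -/

/-- The differential of a function on `Phase`. -/
def differential (ham : M.Phase → ℝ) (p : M.Phase) : M.PhaseTangent →L[ℝ] ℝ :=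
  mfderiv M.phaseModel 𝓘(ℝ, ℝ) ham p

/-- `W` is the value at `p` of the Hamiltonian vector field: `i_W Ω = dℋ` at `p`. -/
def IsHamiltonianVector (ham : M.Phase → ℝ) (p : M.Phase) (W : M.PhaseTangent) : Prop :=
  ∀ V : M.PhaseTangent, M.symplecticForm p W V = M.differential ham p V

/-- The curve `c`, considered on the set `J` of times, solves Hamilton's equations: at each time
its velocity is the Hamiltonian vector. -/
def SolvesHamilton (ham : M.Phase → ℝ) (J : Set ℝ) (c : ℝ → M.Phase) : Prop :=
  ∀ t ∈ J, ∃ W : M.PhaseTangent, M.IsHamiltonianVector ham (c t) W ∧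
    HasMFDerivWithinAt 𝓘(ℝ, ℝ) M.phaseModel c J t (ContinuousLinearMap.toSpanSingleton ℝ W)

/-- `δℋ/δμ ∈ 𝔤** = 𝔤`. -/
def dMu (ham : M.Phase → ℝ) (μ : StrongDual ℝ E) (ν : StrongDual ℝ F) (g : G) (h : H) : E :=
  ofBidual (fderiv ℝ (fun μ' => ham ((μ', ν), (g, h))) μ)

/-- `δℋ/δν ∈ 𝔥** = 𝔥`. -/
def dNu (ham : M.Phase → ℝ) (μ : StrongDual ℝ E) (ν : StrongDual ℝ F) (g : G) (h : H) : F :=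
  ofBidual (fderiv ℝ (fun ν' => ham ((μ, ν'), (g, h))) ν)

/-- `δℋ/δg ∈ T*_g G`. -/
def dG (ham : M.Phase → ℝ) (μ : StrongDual ℝ E) (ν : StrongDual ℝ F) (g : G) (h : H) :
    StrongDual ℝ E :=
  mfderiv 𝓘(ℝ, E) 𝓘(ℝ, ℝ) (fun g' : G => ham ((μ, ν), (g', h))) g

/-- `δℋ/δh ∈ T*_h H`. -/
def dH (ham : M.Phase → ℝ) (μ : StrongDual ℝ E) (ν : StrongDual ℝ F) (g : G) (h : H) :
    StrongDual ℝ F :=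
  mfderiv 𝓘(ℝ, F) 𝓘(ℝ, ℝ) (fun h' : H => ham ((μ, ν), (g, h'))) h

end LieMatchedPair

end

/-!
Write `z = (ξ, η) = (δℋ/δμ, δℋ/δν)` and let `γ = (δℋ/δg, δℋ/δh)` be the differential of `ℋ` along the
group. The generator of a tangent vector at `(m, p)`, `m = (μ, ν)`, is the pair `(m₁, z₁)` whose right
invariant field takes that value there. Evaluated on the field generated by `(m₂, z₂)`, the equation
`i_X Ω = dℋ` for the vector generated by `(m₁, z₁)` reads
`⟨m₂, z₁⟩ - ⟨m₁, z₂⟩ + ⟨m, [z₁, z₂]⟩ = ⟨m₂, z⟩ + ⟨ad*_{z₂} m, z⟩ + ⟨γ, TR_p z₂⟩`.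
Taking `z₂ = 0` forces `z₁ = z`. The bracket on the left then equals `⟨ad*_{z₂} m, z⟩` by antisymmetry
of the bracket of `𝔤 ⋈ 𝔥`, and what remains is `m₁ = -TR_p* γ`. The Hamiltonian vector is therefore
`(-TR_p* γ + ad*_z m, TR_p z)`.

It becomes the right-hand side of the four stated equations once `TR_p` and `ad*_z` are split into
components: `tRBowtie_apply` gives `TR_{(g,h)} (ξ, η) = (TR_g ξ + η ▷ g, TR_h (η ◁ g))`, and
`coadjBowtie_mk` splits the coadjoint action. The statement on curves then holds because a
curve in a product has a given velocity exactly when its components do.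
-/

/-! ### Velocities of curves in products -/

theorem hasMFDerivWithinAt_toSpanSingleton_prodMk_iff {A B K L P Q : Type*}
    [NormedAddCommGroup A] [NormedSpace ℝ A] [NormedAddCommGroup B] [NormedSpace ℝ B]
    [TopologicalSpace K] [TopologicalSpace L]
    {I : ModelWithCorners ℝ A K} {I' : ModelWithCorners ℝ B L}
    [TopologicalSpace P] [ChartedSpace K P] [TopologicalSpace Q] [ChartedSpace L Q]
    {J : Set ℝ} {t : ℝ} {c : ℝ → P} {d : ℝ → Q} {a : A} {b : B} :
    HasMFDerivWithinAt 𝓘(ℝ, ℝ) (I.prod I') (fun s => (c s, d s)) J t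
        (ContinuousLinearMap.toSpanSingleton ℝ ((a, b) : A × B)) ↔
      HasMFDerivWithinAt 𝓘(ℝ, ℝ) I c J t (ContinuousLinearMap.toSpanSingleton ℝ (a : A)) ∧
        HasMFDerivWithinAt 𝓘(ℝ, ℝ) I' d J t (ContinuousLinearMap.toSpanSingleton ℝ (b : B)) := by
  constructor
  · intro hcd
    refine ⟨?_, ?_⟩
    · exact ((hasMFDerivAt_fst (I := I) (I' := I') (c t, d t)).comp_hasMFDerivWithinAt t
        hcd).congr_mfderiv (ContinuousLinearMap.ext fun r => rfl)
    · exact ((hasMFDerivAt_snd (I := I) (I' := I') (c t, d t)).comp_hasMFDerivWithinAt t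
        hcd).congr_mfderiv (ContinuousLinearMap.ext fun r => rfl)
  · rintro ⟨hc, hd⟩
    exact (hc.prodMk hd).congr_mfderiv (ContinuousLinearMap.ext fun r => rfl)

theorem hasMFDerivWithinAt_toSpanSingleton_iff {A : Type*} [NormedAddCommGroup A]
    [NormedSpace ℝ A] {J : Set ℝ} {t : ℝ} {c : ℝ → A} {a : A} :
    HasMFDerivWithinAt 𝓘(ℝ, ℝ) 𝓘(ℝ, A) c J t
        (ContinuousLinearMap.toSpanSingleton ℝ (a : A)) ↔ HasDerivWithinAt c a J t := by
  rw [hasDerivWithinAt_iff_hasFDerivWithinAt]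
  exact hasMFDerivWithinAt_iff_hasFDerivWithinAt

theorem hasDerivWithinAt_prodMk_iff {A B : Type*} [NormedAddCommGroup A] [NormedSpace ℝ A]
    [NormedAddCommGroup B] [NormedSpace ℝ B] {J : Set ℝ} {t : ℝ} {c : ℝ → A} {d : ℝ → B}
    {a : A} {b : B} :
    HasDerivWithinAt (fun s => (c s, d s)) (a, b) J t ↔
      HasDerivWithinAt c a J t ∧ HasDerivWithinAt d b J t := by
  refine ⟨fun hcd => ⟨?_, ?_⟩, fun hcd => hcd.1.prodMk hcd.2⟩
  · have hc := (hasFDerivAt_fst (𝕜 := ℝ) (p := (c t, d t))).comp_hasDerivWithinAt t hcd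
    exact hc
  · have hd := (hasFDerivAt_snd (𝕜 := ℝ) (p := (c t, d t))).comp_hasDerivWithinAt t hcd
    exact hd

/-! ### The matched pair Lie algebra and the right translations of the matched pair group -/

theorem adj_antisymm {E : Type*} [NormedAddCommGroup E] [NormedSpace ℝ E] [FiniteDimensional ℝ E]
    (G : Type*) [TopologicalSpace G] [ChartedSpace E G] [Group G] [LieGroup 𝓘(ℝ, E) ∞ G]
    (x y : E) : adj G x y = -adj G y x := by
  have : LieGroup 𝓘(ℝ, E) (minSmoothness ℝ 3) G :=
    LieGroup.of_le (n := ∞) (by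
      rw [minSmoothness_of_isRCLikeNormedField]; exact ENat.LEInfty.out)
  have : CompleteSpace E := FiniteDimensional.complete ℝ E
  rw [adj_apply, adj_apply]
  exact (lie_skew (L := GroupLieAlgebra 𝓘(ℝ, E) G) x y).symm

namespace LieMatchedPair

variable {E F G H : Type*}
    [NormedAddCommGroup E] [NormedSpace ℝ E] [FiniteDimensional ℝ E]
    [NormedAddCommGroup F] [NormedSpace ℝ F] [FiniteDimensional ℝ F]
    [TopologicalSpace G] [ChartedSpace E G] [Group G] [LieGroup 𝓘(ℝ, E) ∞ G]
    [TopologicalSpace H] [ChartedSpace F H] [Group H] [LieGroup 𝓘(ℝ, F) ∞ H]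
    (M : LieMatchedPair E F G H)

theorem bracket_antisymm (z w : E × F) : M.bracket z w = -M.bracket w z := by
  obtain ⟨x, y⟩ := z
  obtain ⟨x', y'⟩ := w
  rw [bracket_apply, bracket_apply, adj_antisymm G x x', adj_antisymm H y y']
  ext <;> simp <;> abel

theorem pairing_coadjBowtie (z z' : E × F) (m : StrongDual ℝ E × StrongDual ℝ F) :
    pairing (M.coadjBowtie z m) z' = -pairing m (M.bracket z z') := by
  have h : z' = ContinuousLinearMap.inl ℝ E F z'.1 + ContinuousLinearMap.inr ℝ E F z'.2 := by simp
  conv_rhs => rw [h, map_add]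
  simp only [pairing, coadjBowtie, neg_apply, ContinuousLinearMap.comp_apply,
    ContinuousLinearMap.coprod_apply, Prod.fst_add, Prod.snd_add, map_add]
  ring

theorem coadjBowtie_mk (ξ : E) (η : F) (μ : StrongDual ℝ E) (ν : StrongDual ℝ F) :
    M.coadjBowtie (ξ, η) (μ, ν) =
      (coadj G ξ μ - M.dualRight μ η - M.aDual η ν,
        coadj H η ν + M.dualLeft ξ ν + M.bDual ξ μ) := by
  ext x
  · simp [coadjBowtie, bracket_apply, coadj, dualRight, aDual, aMap]; ring
  · simp [coadjBowtie, bracket_apply, coadj, dualLeft, bDual, bMap]; ring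

/-- Right translation by `(g, h)` is `(x, y) ↦ (x (y ▷ g), (y ◁ g) h)`; since `e ▷ g = g` and
`e ◁ g = e`, the chain rule at the identity gives the two components. -/
theorem tRBowtie_apply (g : G) (h : H) (ξ : E) (η : F) :
    M.tRBowtie ((g, h) : G × H) (ξ, η) =
      (tR g ξ + M.algOnGrp g η, tR h (M.grpRight g η)) := by
  have hρ : ContMDiff 𝓘(ℝ, F) 𝓘(ℝ, E) ∞ (fun y : H => M.ρ y g) :=
    M.smooth_ρ.comp (contMDiff_id.prodMk contMDiff_const)
  have hσ : ContMDiff 𝓘(ℝ, F) 𝓘(ℝ, F) ∞ (fun y : H => M.σ y g) :=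
    M.smooth_σ.comp (contMDiff_id.prodMk contMDiff_const)
  have h1 : ContMDiff (𝓘(ℝ, E).prod 𝓘(ℝ, F)) 𝓘(ℝ, E) ∞
      (fun x : G × H => x.1 * M.ρ x.2 g) := contMDiff_fst.mul (hρ.comp contMDiff_snd)
  have hmul : ContMDiff 𝓘(ℝ, F) 𝓘(ℝ, F) ∞ (fun y : H => y * h) := contMDiff_mul_right
  have h2' : ContMDiff 𝓘(ℝ, F) 𝓘(ℝ, F) ∞ (fun y : H => M.σ y g * h) := hmul.comp hσ
  have h2 : ContMDiff (𝓘(ℝ, E).prod 𝓘(ℝ, F)) 𝓘(ℝ, F) ∞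
      (fun x : G × H => M.σ x.2 g * h) := h2'.comp contMDiff_snd
  have d1 := h1.mdifferentiable (by simp) ((1, 1) : G × H)
  have d2 := h2.mdifferentiable (by simp) ((1, 1) : G × H)
  have key : M.tRBowtie ((g, h) : G × H) (ξ, η) =
      ((mfderiv (𝓘(ℝ, E).prod 𝓘(ℝ, F)) 𝓘(ℝ, E) (fun x : G × H => x.1 * M.ρ x.2 g) (1, 1) :
          E × F →L[ℝ] E) (ξ, η),
        (mfderiv (𝓘(ℝ, E).prod 𝓘(ℝ, F)) 𝓘(ℝ, F) (fun x : G × H => M.σ x.2 g * h) (1, 1) :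
          E × F →L[ℝ] F) (ξ, η)) :=
    DFunLike.congr_fun (mfderiv_prodMk d1 d2) (ξ, η)
  rw [key]
  refine Prod.ext ?_ ?_
  · refine (mfderiv_prod_eq_add_apply (v := (ξ, η)) d1).trans ?_
    have hG : (fun x : G => x * M.ρ 1 g) = fun x => x * g := by simp only [M.one_ρ]
    have hH : (fun y : H => 1 * M.ρ y g) = fun y => M.ρ y g := by simp only [one_mul]
    exact congr_arg₂ (· + ·)
      (congr_arg (fun f : G → G => (mfderiv 𝓘(ℝ, E) 𝓘(ℝ, E) f 1 : E →L[ℝ] E) ξ) hG)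
      (congr_arg (fun f : H → G => (mfderiv 𝓘(ℝ, F) 𝓘(ℝ, E) f 1 : F →L[ℝ] E) η) hH)
  · refine (mfderiv_prod_eq_add_apply (v := (ξ, η)) d2).trans ?_
    have hc : (mfderiv 𝓘(ℝ, F) 𝓘(ℝ, F) (fun y : H => M.σ y g * h) 1 : F →L[ℝ] F) =
        tR h ∘L M.grpRight g := by
      have hm : HasMFDerivAt 𝓘(ℝ, F) 𝓘(ℝ, F) (fun y : H => y * h) (M.σ 1 g)
          (tR h : F →L[ℝ] F) := by
        rw [M.one_σ]
        exact (hmul.mdifferentiable (by simp) 1).hasMFDerivAt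
      exact (hm.comp 1 (hσ.mdifferentiable (by simp) 1).hasMFDerivAt).mfderiv
    simp only [mfderiv_const]
    refine (zero_add _).trans ?_
    exact DFunLike.congr_fun hc η

/-! ### The differential of the Hamiltonian -/

/-- The differential is the sum of the partial derivatives; those in `μ` and `ν` appear as vectors of
`𝔤` and `𝔥` paired with the variations of `μ` and `ν`. -/
theorem differential_apply {ham : M.Phase → ℝ} (hham : MDifferentiable M.phaseModel 𝓘(ℝ, ℝ) ham)
    (μ : StrongDual ℝ E) (ν : StrongDual ℝ F) (g : G) (h : H)
    (a : StrongDual ℝ E) (b : StrongDual ℝ F) (u : E) (v : F) :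
    M.differential ham ((μ, ν), (g, h)) ((a, b), (u, v)) =
      a (M.dMu ham μ ν g h) + b (M.dNu ham μ ν g h)
        + (M.dG ham μ ν g h u + M.dH ham μ ν g h v) := by
  have h1 : MDifferentiableAt 𝓘(ℝ, StrongDual ℝ E × StrongDual ℝ F) 𝓘(ℝ, ℝ)
      (fun m => ham (m, (g, h))) (μ, ν) :=
    (hham ((μ, ν), (g, h))).comp (μ, ν) (mdifferentiableAt_id.prodMk mdifferentiableAt_const)
  have h2 : MDifferentiableAt (𝓘(ℝ, E).prod 𝓘(ℝ, F)) 𝓘(ℝ, ℝ)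
      (fun q : G × H => ham ((μ, ν), q)) (g, h) :=
    (hham ((μ, ν), (g, h))).comp (g, h)
      ((mdifferentiableAt_const (I' := 𝓘(ℝ, StrongDual ℝ E × StrongDual ℝ F))).prodMk
        (mdifferentiableAt_id (I := 𝓘(ℝ, E).prod 𝓘(ℝ, F)) (M := M.Bowtie)))
  rw [mdifferentiableAt_iff_differentiableAt] at h1
  have e1 : fderiv ℝ (fun m => ham (m, (g, h))) (μ, ν) (a, b) =
      a (M.dMu ham μ ν g h) + b (M.dNu ham μ ν g h) := by
    have l : HasFDerivAt (fun μ' => ham ((μ', ν), (g, h)))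
        ((fderiv ℝ (fun m => ham (m, (g, h))) (μ, ν)) ∘L ContinuousLinearMap.inl ℝ _ _) μ :=
      HasFDerivAt.comp (g := fun m => ham (m, (g, h))) μ h1.hasFDerivAt
        (hasFDerivAt_prodMk_left μ ν)
    have r : HasFDerivAt (fun ν' => ham ((μ, ν'), (g, h)))
        ((fderiv ℝ (fun m => ham (m, (g, h))) (μ, ν)) ∘L ContinuousLinearMap.inr ℝ _ _) ν :=
      HasFDerivAt.comp (g := fun m => ham (m, (g, h))) ν h1.hasFDerivAt
        (hasFDerivAt_prodMk_right μ ν)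
    rw [dMu, dNu, apply_ofBidual, apply_ofBidual, l.fderiv, r.fderiv,
      ContinuousLinearMap.comp_apply, ContinuousLinearMap.comp_apply, ← map_add]
    simp
  rw [← e1]
  refine (mfderiv_prod_eq_add_apply (I := 𝓘(ℝ, StrongDual ℝ E × StrongDual ℝ F))
    (I' := 𝓘(ℝ, E).prod 𝓘(ℝ, F)) (v := ((a, b), (u, v))) (hham ((μ, ν), (g, h)))).trans ?_
  refine congr_arg₂ (· + ·) ?_ ?_
  · rw [mfderiv_eq_fderiv]
    rfl
  · exact mfderiv_prod_eq_add_apply (I := 𝓘(ℝ, E)) (I' := 𝓘(ℝ, F)) (v := (u, v)) h2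

/-! ### The Hamiltonian vector field -/

/-- The right-hand side of Hamilton's equations at the point `((μ, ν), (g, h))`. -/
noncomputable def hamiltonVector (ham : M.Phase → ℝ) (μ : StrongDual ℝ E) (ν : StrongDual ℝ F)
    (g : G) (h : H) : M.PhaseTangent :=
  let ξ : E := M.dMu ham μ ν g h
  let η : F := M.dNu ham μ ν g h
  let α : StrongDual ℝ E := M.dG ham μ ν g h
  let β : StrongDual ℝ F := M.dH ham μ ν g h
  ((-(α ∘L tR g) + coadj G ξ μ - M.dualRight μ η - M.aDual η ν,
    -(α ∘L M.algOnGrp g) - M.grpDualLeft g (β ∘L tR h)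
      + coadj H η ν + M.dualLeft ξ ν + M.bDual ξ μ),
    (tR g ξ + M.algOnGrp g η, tR h (M.grpRight g η)))

/-- The Hamiltonian vector is generated by `(-TR*(δℋ/δ(g, h)), δℋ/δ(μ, ν))`. -/
theorem hamiltonVector_eq_rightInvField (ham : M.Phase → ℝ) (μ : StrongDual ℝ E)
    (ν : StrongDual ℝ F) (g : G) (h : H) :
    M.hamiltonVector ham μ ν g h =
      M.rightInvField
        ((-(M.dG ham μ ν g h ∘L tR g),
          -(M.dG ham μ ν g h ∘L M.algOnGrp g)
            - M.grpDualLeft g (M.dH ham μ ν g h ∘L tR h)),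
          (M.dMu ham μ ν g h, M.dNu ham μ ν g h)) ((μ, ν), (g, h)) := by
  have h1 := M.tRBowtie_apply g h (M.dMu ham μ ν g h) (M.dNu ham μ ν g h)
  simp only [rightInvField, h1, coadjBowtie_mk, hamiltonVector, Prod.mk_add_mk]
  refine Prod.ext (Prod.ext ?_ ?_) rfl <;> dsimp only <;> abel

/-- `Ω` is nondegenerate in its first argument. -/
theorem symplecticForm_left_injective {p : M.Phase} {W W' : M.PhaseTangent}
    (hW : ∀ V, M.symplecticForm p W V = M.symplecticForm p W' V) : W = W' := by
  rw [← M.rightInvField_generator p W, ← M.rightInvField_generator p W'] at hW ⊢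
  generalize M.generator p W = Z at hW
  generalize M.generator p W' = Z' at hW
  obtain ⟨⟨a, b⟩, x, y⟩ := Z
  obtain ⟨⟨a', b'⟩, x', y'⟩ := Z'
  have key (m : StrongDual ℝ E × StrongDual ℝ F) (z : E × F) :
      pairing m (x, y) - pairing (a, b) z + pairing p.1 (M.bracket (x, y) z) =
        pairing m (x', y') - pairing (a', b') z + pairing p.1 (M.bracket (x', y') z) := by
    rw [← symplecticForm_rightInvField, ← symplecticForm_rightInvField]
    exact hW _
  -- testing against `z = 0` separates the components along the group
  obtain rfl : x = x' := by
    refine (SeparatingDual.eq_iff_forall_dual_eq (R := ℝ)).2 fun f => ?_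
    simpa [pairing] using key (f, 0) 0
  obtain rfl : y = y' := by
    refine (SeparatingDual.eq_iff_forall_dual_eq (R := ℝ)).2 fun f => ?_
    simpa [pairing] using key (0, f) 0
  -- the bracket terms now agree, so testing against `m = 0` separates the momenta
  obtain rfl : a = a' := by
    ext u
    simpa [pairing] using key 0 (u, 0)
  obtain rfl : b = b' := by
    ext u
    simpa [pairing] using key 0 (0, u)
  rfl

theorem isHamiltonianVector_hamiltonVector {ham : M.Phase → ℝ}
    (hham : MDifferentiable M.phaseModel 𝓘(ℝ, ℝ) ham)
    (μ : StrongDual ℝ E) (ν : StrongDual ℝ F) (g : G) (h : H) :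
    M.IsHamiltonianVector ham ((μ, ν), (g, h)) (M.hamiltonVector ham μ ν g h) := by
  intro V
  rw [← M.rightInvField_generator ((μ, ν), (g, h)) V, hamiltonVector_eq_rightInvField]
  obtain ⟨⟨a, b⟩, u, v⟩ := M.generator ((μ, ν), (g, h)) V
  rw [symplecticForm_rightInvField]
  have hR := M.tRBowtie_apply g h u v
  have hc := M.pairing_coadjBowtie (u, v) (M.dMu ham μ ν g h, M.dNu ham μ ν g h) (μ, ν)
  rw [M.bracket_antisymm (u, v)] at hc
  simp only [rightInvField, hR]
  generalize M.coadjBowtie (u, v) (μ, ν) = m at hc ⊢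
  obtain ⟨c, d⟩ := m
  simp only [Prod.mk_add_mk]
  rw [M.differential_apply hham]
  simp only [pairing, Prod.fst_neg, Prod.snd_neg, map_neg, grpDualLeft,
    neg_apply, sub_apply, add_apply,
    ContinuousLinearMap.comp_apply, map_add] at hc ⊢
  linarith

theorem isHamiltonianVector_iff {ham : M.Phase → ℝ}
    (hham : MDifferentiable M.phaseModel 𝓘(ℝ, ℝ) ham)
    (μ : StrongDual ℝ E) (ν : StrongDual ℝ F) (g : G) (h : H) (W : M.PhaseTangent) :
    M.IsHamiltonianVector ham ((μ, ν), (g, h)) W ↔ W = M.hamiltonVector ham μ ν g h := by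
  have h0 := M.isHamiltonianVector_hamiltonVector hham μ ν g h
  refine ⟨fun hW => M.symplecticForm_left_injective fun V => (hW V).trans (h0 V).symm, ?_⟩
  rintro rfl
  exact h0

end LieMatchedPair

/-! ### Hamilton's equations in components -/

theorem mainTheorem2 {E F G H : Type*}
    [NormedAddCommGroup E] [NormedSpace ℝ E] [FiniteDimensional ℝ E]
    [NormedAddCommGroup F] [NormedSpace ℝ F] [FiniteDimensional ℝ F]
    [TopologicalSpace G] [ChartedSpace E G] [Group G] [LieGroup 𝓘(ℝ, E) ∞ G]
    [TopologicalSpace H] [ChartedSpace F H] [Group H] [LieGroup 𝓘(ℝ, F) ∞ H]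
    (M : LieMatchedPair E F G H)
    (ham : M.Phase → ℝ) (hham : MDifferentiable M.phaseModel 𝓘(ℝ, ℝ) ham) :
    (∀ p : M.Phase, ∃! W : M.PhaseTangent, M.IsHamiltonianVector ham p W) ∧
    ∀ (J : Set ℝ) (μ : ℝ → StrongDual ℝ E) (ν : ℝ → StrongDual ℝ F) (g : ℝ → G) (h : ℝ → H),
      M.SolvesHamilton ham J (fun t => ((μ t, ν t), (g t, h t))) ↔
        ∀ t ∈ J,
          let ξ : E := M.dMu ham (μ t) (ν t) (g t) (h t)
          let η : F := M.dNu ham (μ t) (ν t) (g t) (h t)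
          let α : StrongDual ℝ E := M.dG ham (μ t) (ν t) (g t) (h t)
          let β : StrongDual ℝ F := M.dH ham (μ t) (ν t) (g t) (h t)
          HasMFDerivWithinAt 𝓘(ℝ, ℝ) 𝓘(ℝ, E) g J t
              (ContinuousLinearMap.toSpanSingleton ℝ (tR (g t) ξ + M.algOnGrp (g t) η : E)) ∧
          HasMFDerivWithinAt 𝓘(ℝ, ℝ) 𝓘(ℝ, F) h J t
              (ContinuousLinearMap.toSpanSingleton ℝ (tR (h t) (M.grpRight (g t) η) : F)) ∧
          HasDerivWithinAt μ
              (-(α ∘L tR (g t)) + coadj G ξ (μ t)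
                - M.dualRight (μ t) η - M.aDual η (ν t)) J t ∧
          HasDerivWithinAt ν
              (-(α ∘L M.algOnGrp (g t)) - M.grpDualLeft (g t) (β ∘L tR (h t))
                + coadj H η (ν t) + M.dualLeft ξ (ν t) + M.bDual ξ (μ t)) J t := by
  refine ⟨fun p => ?_, fun J μ ν g h => forall₂_congr fun t _ => ?_⟩
  · obtain ⟨⟨μ, ν⟩, g, h⟩ := p
    exact ⟨_, M.isHamiltonianVector_hamiltonVector hham μ ν g h,
      fun W hW => (M.isHamiltonianVector_iff hham μ ν g h W).1 hW⟩
  · simp only [M.isHamiltonianVector_iff hham, exists_eq_left, LieMatchedPair.hamiltonVector]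
    refine hasMFDerivWithinAt_toSpanSingleton_prodMk_iff.trans ?_
    rw [hasMFDerivWithinAt_toSpanSingleton_iff, hasDerivWithinAt_prodMk_iff]
    refine (and_congr_right' hasMFDerivWithinAt_toSpanSingleton_prodMk_iff).trans ?_
    tauto
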